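/- Let $m\ge 2$, let $\mathbb F_m$ be the free group on $m$ generators, and let $F$ be the first-order structure consisting of the group $\mathbb F_m$ together with a unary predicate for every subset of $\mathbb F_m$; let $L$ be its language. Let $F^*\succ F$ be a monster model, that is, an elementary extension of $F$ which, for some cardinal $\kappa>2^{|L|}$, is $\kappa$-saturated and strongly $\kappa$-homogeneous (every partial elementary map between subsets of cardinality less than $\kappa$ extends to an automorphism). Say that a subgroup of the group $F^*$ has bounded index if its index is less than $\kappa$. For a set $B\subseteq F^*$ with $|B|<\kappa$, let ${F^*}^{000}_B$ denote the smallest subgroup of bounded index of $F^*$ that is invariant under all automorphisms of the structure $F^*$ fixing $B$ pointwise, and let ${F^*}^{00}_B$ denote the smallest subgroup of bounded index of $F^*$ that is an intersection of $B$-definable sets. Then these smallest subgroups exist for $B=\emptyset$ and for $B=F$ (the set of elements of $F$ inside $F^*$), and $${F^*}^{000}_F={F^*}^{000}_\emptyset\neq{F^*}^{00}_\emptyset={F^*}^{00}_F .$$ -/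

import Mathlib

open FirstOrder Cardinal

universe u v w

/-- Function symbols of the language of groups. -/
inductive GroupFunc : ℕ → Type
  | one : GroupFunc 0
  | inv : GroupFunc 1
  | mul : GroupFunc 2

/-- Relation symbols: one unary predicate for each subset of `G`. -/
inductive SubsetRel (G : Type u) : ℕ → Type u
  | pred (D : Set G) : SubsetRel G 1

/-- The language of groups together with a unary predicate for every subset of `G`. -/
def fullGroupLang (G : Type u) : FirstOrder.Language.{0, u} :=
  ⟨GroupFunc, SubsetRel G⟩

/-- The group `G` expanded by predicates for all subsets of `G`. -/
instance fullGroupStructure (G : Type u) [Group G] : (fullGroupLang G).Structure G where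
  funMap {n} (f : GroupFunc n) := match n, f with
    | _, .one => fun _ => 1
    | _, .inv => fun x => (x 0)⁻¹
    | _, .mul => fun x => x 0 * x 1
  RelMap {n} (r : SubsetRel G n) := match n, r with
    | _, .pred D => fun x => x 0 ∈ D

/-- The language of the free group on `m` generators expanded by predicates for all subsets. -/
abbrev freeLang (m : ℕ) : FirstOrder.Language.{0, 0} := fullGroupLang (FreeGroup (Fin m))

section GroupOfExtension

variable {G : Type u} {M : Type w} [(fullGroupLang G).Structure M]

/-- The terms `1`, `t⁻¹`, `t * s` of the language. -/
def oneTerm (G : Type u) {α : Type v} : (fullGroupLang G).Term α :=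
  .func (L := fullGroupLang G) (l := 0) GroupFunc.one ![]

def invTerm {α : Type v} (t : (fullGroupLang G).Term α) : (fullGroupLang G).Term α :=
  .func (L := fullGroupLang G) (l := 1) GroupFunc.inv ![t]

def mulTerm {α : Type v} (t s : (fullGroupLang G).Term α) : (fullGroupLang G).Term α :=
  .func (L := fullGroupLang G) (l := 2) GroupFunc.mul ![t, s]

/-- The interpretations of the group symbols in a structure of the language. -/
def interpOne (G : Type u) (M : Type w) [(fullGroupLang G).Structure M] : M :=
  FirstOrder.Language.Structure.funMap (L := fullGroupLang G) (n := 0) GroupFunc.one ![]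

def interpInv (G : Type u) {M : Type w} [(fullGroupLang G).Structure M] (x : M) : M :=
  FirstOrder.Language.Structure.funMap (L := fullGroupLang G) (n := 1) GroupFunc.inv ![x]

def interpMul (G : Type u) {M : Type w} [(fullGroupLang G).Structure M] (x y : M) : M :=
  FirstOrder.Language.Structure.funMap (L := fullGroupLang G) (n := 2) GroupFunc.mul ![x, y]

theorem realize_oneTerm {α : Type v} (x : α → M) :
    (oneTerm G : (fullGroupLang G).Term α).realize x = interpOne G M := by
  refine congrArg (FirstOrder.Language.Structure.funMap (L := fullGroupLang G) (M := M) (n := 0)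
    GroupFunc.one) (funext fun k => ?_)
  exact k.elim0

theorem realize_invTerm {α : Type v} (t : (fullGroupLang G).Term α) (x : α → M) :
    (invTerm t).realize x = interpInv G (t.realize x) := by
  refine congrArg (FirstOrder.Language.Structure.funMap (L := fullGroupLang G) (M := M) (n := 1)
    GroupFunc.inv) (funext fun k => ?_)
  fin_cases k
  rfl

theorem realize_mulTerm {α : Type v} (t s : (fullGroupLang G).Term α) (x : α → M) :
    (mulTerm t s).realize x = interpMul G (t.realize x) (s.realize x) := by
  refine congrArg (FirstOrder.Language.Structure.funMap (L := fullGroupLang G) (M := M) (n := 2)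
    GroupFunc.mul) (funext fun k => ?_)
  fin_cases k <;> rfl

/-- An identity between two terms passes from `G` to an elementary extension. -/
theorem identity_transfer [Group G] (i : G ↪ₑ[fullGroupLang G] M) {n : ℕ}
    (t s : (fullGroupLang G).Term (Empty ⊕ Fin n))
    (h : ∀ x : Empty ⊕ Fin n → G, t.realize x = s.realize x) (y : Fin n → M) :
    t.realize (Sum.elim Empty.elim y) = s.realize (Sum.elim Empty.elim y) := by
  have hG : G ⊨ (FirstOrder.Language.BoundedFormula.alls (t.bdEqual s)) :=
    FirstOrder.Language.BoundedFormula.realize_alls.2 fun xs => h _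
  have hM := FirstOrder.Language.BoundedFormula.realize_alls.1 ((i.map_sentence _).1 hG) y
  rw [FirstOrder.Language.BoundedFormula.realize_bdEqual] at hM
  rwa [show (default : Empty → M) = Empty.elim from Subsingleton.elim _ _] at hM

/-- The group whose operations are the interpretations of the group symbols in an elementary
extension of the expanded group `G`. -/
@[reducible]
def extensionGroup [Group G] (i : G ↪ₑ[fullGroupLang G] M) : Group M :=
  letI : Mul M := ⟨interpMul G⟩
  letI : Inv M := ⟨interpInv G⟩
  letI : One M := ⟨interpOne G M⟩
  Group.ofLeftAxioms
    (fun a b c => by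
      have := identity_transfer i (n := 3)
        (mulTerm (mulTerm (.var (.inr 0)) (.var (.inr 1))) (.var (.inr 2)))
        (mulTerm (.var (.inr 0)) (mulTerm (.var (.inr 1)) (.var (.inr 2))))
        (fun x => by
          simp only [realize_mulTerm, FirstOrder.Language.Term.realize_var]
          exact mul_assoc (x (.inr 0)) (x (.inr 1)) (x (.inr 2))) ![a, b, c]
      simp only [realize_mulTerm, FirstOrder.Language.Term.realize_var] at this
      exact this)
    (fun a => by
      have := identity_transfer i (n := 1)
        (mulTerm (oneTerm G) (.var (.inr 0))) (.var (.inr 0))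
        (fun x => by
          simp only [realize_mulTerm, realize_oneTerm, FirstOrder.Language.Term.realize_var]
          exact one_mul (x (.inr 0))) ![a]
      simp only [realize_mulTerm, realize_oneTerm, FirstOrder.Language.Term.realize_var] at this
      exact this)
    (fun a => by
      have := identity_transfer i (n := 1)
        (mulTerm (invTerm (.var (.inr 0))) (.var (.inr 0))) (oneTerm G)
        (fun x => by
          simp only [realize_mulTerm, realize_invTerm, realize_oneTerm, FirstOrder.Language.Term.realize_var]
          exact inv_mul_cancel (x (.inr 0))) ![a]
      simp only [realize_mulTerm, realize_invTerm, realize_oneTerm,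
        FirstOrder.Language.Term.realize_var] at this
      exact this)

end GroupOfExtension

section Monster

variable (L : FirstOrder.Language.{u, v}) (M : Type w) [L.Structure M]

/-- `M` is `κ`-saturated: every set of formulas in one variable over fewer than `κ` parameters
that is finitely satisfiable in `M` is realized in `M`. -/
def IsSaturatedModel (κ : Cardinal.{w}) : Prop :=
  ∀ A : Set M, #A < κ → ∀ p : Set (L[[A]].Formula (Fin 1)),
    (∀ q : Set (L[[A]].Formula (Fin 1)), q ⊆ p → q.Finite →
      ∃ a : M, ∀ φ ∈ q, φ.Realize (fun _ => a)) →
    ∃ a : M, ∀ φ ∈ p, φ.Realize (fun _ => a)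

/-- `M` is strongly `κ`-homogeneous: every partial elementary map whose domain has fewer than `κ`
elements extends to an automorphism of `M`. -/
def IsStronglyHomogeneous (κ : Cardinal.{w}) : Prop :=
  ∀ A : Set M, #A < κ → ∀ f : A → M,
    (∀ φ : L.Formula A, φ.Realize (fun a : A => (a : M)) ↔ φ.Realize f) →
    ∃ σ : M ≃[L] M, ∀ a : A, σ a = f a

/-- `M` is a monster model with respect to the cardinal `κ`; "small" and "bounded" then mean
"of cardinality smaller than `κ`". -/
structure IsMonster (κ : Cardinal.{w}) : Prop where
  large : Cardinal.lift.{w} ((2 : Cardinal.{max u v}) ^ max ℵ₀ L.card)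
    < Cardinal.lift.{max u v} κ
  saturated : IsSaturatedModel L M κ
  homogeneous : IsStronglyHomogeneous L M κ

end Monster

section Components

variable (L : FirstOrder.Language.{u, v}) {M : Type w} [L.Structure M] [Group M]

/-- `H` has bounded index, that is, fewer than `κ` cosets. -/
def HasBoundedIndex (κ : Cardinal.{w}) (H : Subgroup M) : Prop := #(M ⧸ H) < κ

/-- `X` is invariant under all automorphisms of `M` that fix `B` pointwise. -/
def IsInvariantOver (B X : Set M) : Prop :=
  ∀ σ : M ≃[L] M, (∀ b ∈ B, σ b = b) → σ '' X = X

/-- `X` is type-definable over `B`: an intersection of `B`-definable sets. -/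
def IsTypeDefinableOver (B X : Set M) : Prop :=
  ∃ S : Set (Set M), (∀ D ∈ S, B.Definable₁ L D) ∧ X = ⋂₀ S

/-- The `B`-invariant subgroups of bounded index. -/
def invariantBounded (κ : Cardinal.{w}) (B : Set M) : Set (Subgroup M) :=
  {H | IsInvariantOver L B (H : Set M) ∧ HasBoundedIndex κ H}

/-- The subgroups of bounded index that are type-definable over `B`. -/
def typeDefinableBounded (κ : Cardinal.{w}) (B : Set M) : Set (Subgroup M) :=
  {H | IsTypeDefinableOver L B (H : Set M) ∧ HasBoundedIndex κ H}

/-- The intersection of all `B`-invariant subgroups of bounded index; it is the smallest one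
whenever there is a smallest one. -/
def component000 (κ : Cardinal.{w}) (B : Set M) : Subgroup M := sInf (invariantBounded L κ B)

/-- The intersection of all subgroups of bounded index that are type-definable over `B`; it is the
smallest one whenever there is a smallest one. -/
def component00 (κ : Cardinal.{w}) (B : Set M) : Subgroup M :=
  sInf (typeDefinableBounded L κ B)

end Components

/-! Every subset of the free group is named by a predicate. Hence each element of the group is fixed
by all automorphisms and each set definable over `Set.range i` is `interpSet M E` for some `E`, so
parameters from `Set.range i` change neither kind of component. Minimality rests on
`inv_mul_mem_of_sameType`: an invariant subgroup of bounded index contains `a⁻¹ * b` whenever `a`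
and `b` have the same type. The intersection of all such subgroups then contains these elements too,
so its index is at most the number of types.

For the inequality, let the free group act on the line by lifts of circle maps; `ceilZero` is a
quasimorphism into ℤ with error 0 or -1. Elements of equal type have equal residues modulo every `3
^ k`, up to this bounded error. Therefore `residueSubgroup`, where the 3-adic limit of the residues
is an integer, is invariant of bounded index and contains the component 000. That component also
contains nonstandard positive powers `x`, `y` of two generators, and a ping-pong argument gives
`ceilZero` the value `n` on `(x * y) ^ n`. If the component 000 were type-definable, compactness
would put into it a limit of powers whose exponents tend 3-adically to 1/2, which is not an integer.
-/

/-! ### Transfer of subsets and their algebra to the extension -/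

section Stars

variable {G : Type u} {M : Type w} [(fullGroupLang G).Structure M]

/-- The atomic formula asserting that the term `t` belongs to `D`. -/
def memFormula {α : Type v} (D : Set G) (t : (fullGroupLang G).Term α) :
    (fullGroupLang G).Formula α :=
  FirstOrder.Language.Relations.formula₁ (L := fullGroupLang G) (SubsetRel.pred D) t

/-- The interpretation in `M` of the predicate for `D`. -/
def interpSet (M : Type w) [(fullGroupLang G).Structure M] (D : Set G) : Set M :=
  {x | FirstOrder.Language.Structure.RelMap (L := fullGroupLang G) (n := 1)
    (SubsetRel.pred D) ![x]}

theorem realize_memFormula {α : Type v} (D : Set G) (t : (fullGroupLang G).Term α) (v : α → M) :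
    (memFormula D t).Realize v ↔ t.realize v ∈ interpSet M D :=
  FirstOrder.Language.Formula.realize_rel₁

/-- A formula valid in `G` is valid in every elementary extension. -/
theorem formula_transfer [Group G] (i : G ↪ₑ[fullGroupLang G] M) {n : ℕ}
    (φ : (fullGroupLang G).Formula (Empty ⊕ Fin n))
    (h : ∀ v : Fin n → G, φ.Realize (Sum.elim Empty.elim v)) (v : Fin n → M) :
    φ.Realize (Sum.elim Empty.elim v) := by
  have h1 : (φ.iAlls (Fin n)).Realize (Empty.elim : Empty → G) :=
    FirstOrder.Language.Formula.realize_iAlls.2 h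
  rw [← i.map_formula] at h1
  have h2 := FirstOrder.Language.Formula.realize_iAlls.1 h1 v
  rwa [show i ∘ Empty.elim = Empty.elim from Subsingleton.elim _ _] at h2

/-- Definable sets in one variable, with parameters from `G`, are interpretations of predicates. -/
theorem realize_iff_mem_interpSet [Group G] (i : G ↪ₑ[fullGroupLang G] M) {α : Type v}
    (φ : (fullGroupLang G).Formula (α ⊕ Fin 1)) (v : α → G) (x : M) :
    φ.Realize (Sum.elim (i ∘ v) fun _ => x) ↔
      x ∈ interpSet M {g : G | φ.Realize (Sum.elim v fun _ => g)} := by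
  set E : Set G := {g : G | φ.Realize (Sum.elim v fun _ => g)}
  have h1 : ((φ.iff (memFormula E (.var (.inr 0)))).iAlls (Fin 1)).Realize v := by
    refine FirstOrder.Language.Formula.realize_iAlls.2 fun w => ?_
    rw [FirstOrder.Language.Formula.realize_iff, realize_memFormula]
    have : w = fun _ => w 0 := funext fun k => by rw [Subsingleton.elim k 0]
    rw [this]
    rfl
  rw [← i.map_formula] at h1
  have h2 := FirstOrder.Language.Formula.realize_iAlls.1 h1 fun _ => x
  rw [FirstOrder.Language.Formula.realize_iff, realize_memFormula] at h2
  exact h2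

theorem apply_mem_interpSet [Group G] (i : G ↪ₑ[fullGroupLang G] M) {D : Set G} {g : G} :
    i g ∈ interpSet M D ↔ g ∈ D := by
  have := i.map_formula (memFormula D (.var ())) fun _ : Unit => g
  rw [realize_memFormula, realize_memFormula] at this
  exact this

theorem interpSet_mono [Group G] (i : G ↪ₑ[fullGroupLang G] M) {D E : Set G} (h : D ⊆ E) :
    interpSet M D ⊆ interpSet M E := fun x hx => by
  have := formula_transfer i (n := 1)
    ((memFormula D (.var (.inr 0))).imp (memFormula E (.var (.inr 0))))
    (fun v => by
      rw [FirstOrder.Language.Formula.realize_imp, realize_memFormula, realize_memFormula]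
      exact fun hv => h hv) fun _ => x
  rw [FirstOrder.Language.Formula.realize_imp, realize_memFormula, realize_memFormula] at this
  exact this hx

theorem interpSet_compl [Group G] (i : G ↪ₑ[fullGroupLang G] M) (D : Set G) :
    interpSet M Dᶜ = (interpSet M D)ᶜ := Set.ext fun x => by
  have := realize_iff_mem_interpSet i (memFormula D (.var (.inr 0))).not Empty.elim x
  simp only [FirstOrder.Language.Formula.realize_not, realize_memFormula] at this
  exact this.symm

theorem interpSet_inter [Group G] (i : G ↪ₑ[fullGroupLang G] M) (D E : Set G) :
    interpSet M (D ∩ E) = interpSet M D ∩ interpSet M E := Set.ext fun x => by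
  have := realize_iff_mem_interpSet i
    (memFormula D (.var (.inr 0)) ⊓ memFormula E (.var (.inr 0))) Empty.elim x
  simp only [FirstOrder.Language.Formula.realize_inf, realize_memFormula] at this
  exact this.symm

theorem interpSet_union [Group G] (i : G ↪ₑ[fullGroupLang G] M) (D E : Set G) :
    interpSet M (D ∪ E) = interpSet M D ∪ interpSet M E := by
  rw [← compl_compl (D ∪ E), interpSet_compl i, Set.compl_union, interpSet_inter i, interpSet_compl i,
    interpSet_compl i, ← Set.compl_union, compl_compl]

theorem interpSet_univ [Group G] (i : G ↪ₑ[fullGroupLang G] M) : interpSet M (Set.univ : Set G) = Set.univ :=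
  Set.eq_univ_of_forall fun x => by
    have := formula_transfer i (n := 1) (memFormula Set.univ (.var (.inr 0)))
      (fun v => by rw [realize_memFormula]; trivial) fun _ => x
    rwa [realize_memFormula] at this

theorem interpSet_empty [Group G] (i : G ↪ₑ[fullGroupLang G] M) : interpSet M (∅ : Set G) = ∅ := by
  rw [← Set.compl_univ, interpSet_compl i, interpSet_univ i, Set.compl_univ]

theorem nonempty_of_mem_interpSet [Group G] (i : G ↪ₑ[fullGroupLang G] M) {D : Set G} {x : M}
    (h : x ∈ interpSet M D) : D.Nonempty := by
  by_contra hD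
  rw [Set.not_nonempty_iff_eq_empty.1 hD, interpSet_empty i] at h
  exact h

theorem mem_interpSet_sInter [Group G] (i : G ↪ₑ[fullGroupLang G] M) {S : Set (Set G)}
    (hS : S.Finite) {x : M} : x ∈ interpSet M (⋂₀ S) ↔ ∀ D ∈ S, x ∈ interpSet M D := by
  induction S, hS using Set.Finite.induction_on with
  | empty => simp [interpSet_univ i]
  | insert _ _ ih => simp [Set.sInter_insert, interpSet_inter i, ih]

/-- Inclusions between products of sets are first-order, so later computations with elements of `M`
reduce to computations in `G`. -/
theorem interpMul_mem_interpSet [Group G] (i : G ↪ₑ[fullGroupLang G] M) {D E C : Set G}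
    (h : ∀ g ∈ D, ∀ g' ∈ E, g * g' ∈ C) {x y : M} (hx : x ∈ interpSet M D) (hy : y ∈ interpSet M E) :
    interpMul G x y ∈ interpSet M C := by
  have := formula_transfer i (n := 2) ((memFormula D (.var (.inr 0))).imp
    ((memFormula E (.var (.inr 1))).imp
      (memFormula C (mulTerm (.var (.inr 0)) (.var (.inr 1))))))
    (fun v => by
      simp only [FirstOrder.Language.Formula.realize_imp, realize_memFormula, realize_mulTerm]
      exact fun h0 h1 => h _ h0 _ h1) ![x, y]
  simp only [FirstOrder.Language.Formula.realize_imp, realize_memFormula, realize_mulTerm] at this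
  exact this hx hy

theorem interpInv_mem_interpSet [Group G] (i : G ↪ₑ[fullGroupLang G] M) {D C : Set G}
    (h : ∀ g ∈ D, g⁻¹ ∈ C) {x : M} (hx : x ∈ interpSet M D) : interpInv G x ∈ interpSet M C := by
  have := formula_transfer i (n := 1) ((memFormula D (.var (.inr 0))).imp
    (memFormula C (invTerm (.var (.inr 0)))))
    (fun v => by
      simp only [FirstOrder.Language.Formula.realize_imp, realize_memFormula, realize_invTerm]
      exact fun h0 => h _ h0) ![x]
  simp only [FirstOrder.Language.Formula.realize_imp, realize_memFormula, realize_invTerm] at this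
  exact this hx

theorem apply_mem_interpSet_iff (σ : M ≃[fullGroupLang G] M) {D : Set G} {x : M} :
    σ x ∈ interpSet M D ↔ x ∈ interpSet M D := by
  have := σ.map_rel (SubsetRel.pred D : (fullGroupLang G).Relations 1) ![x]
  rw [show σ ∘ ![x] = ![σ x] from funext fun k => by fin_cases k; rfl] at this
  exact this

theorem apply_interpMul (σ : M ≃[fullGroupLang G] M) (x y : M) :
    σ (interpMul G x y) = interpMul G (σ x) (σ y) := by
  have := σ.map_fun (GroupFunc.mul : (fullGroupLang G).Functions 2) ![x, y]
  rw [show σ ∘ ![x, y] = ![σ x, σ y] from funext fun k => by fin_cases k <;> rfl] at this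
  exact this

theorem apply_interpInv (σ : M ≃[fullGroupLang G] M) (x : M) :
    σ (interpInv G x) = interpInv G (σ x) := by
  have := σ.map_fun (GroupFunc.inv : (fullGroupLang G).Functions 1) ![x]
  rw [show σ ∘ ![x] = ![σ x] from funext fun k => by fin_cases k; rfl] at this
  exact this

/-- Sets definable over `G` in an elementary extension are interpretations of predicates. -/
theorem exists_eq_interpSet_of_definable [Group G] (i : G ↪ₑ[fullGroupLang G] M) {B : Set M}
    (hB : B ⊆ Set.range i) {D : Set M} (hD : B.Definable₁ (fullGroupLang G) D) :
    ∃ E : Set G, D = interpSet M E := by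
  obtain ⟨φ, hφ⟩ := Set.definable_iff_exists_formula_sum.1 hD
  choose f hf using fun b : B => hB b.2
  refine ⟨{g : G | φ.Realize (Sum.elim f fun _ => g)}, Set.ext fun x => ?_⟩
  rw [← realize_iff_mem_interpSet i φ f x, show i ∘ f = fun b : B => (b : M) from funext hf]
  exact Set.ext_iff.1 hφ fun _ => x

theorem definable_interpSet (B : Set M) (D : Set G) : B.Definable₁ (fullGroupLang G) (interpSet M D) :=
  Set.definable_iff_exists_formula_sum.2 ⟨memFormula D (.var (.inr 0)), Set.ext fun x => by
    simp [realize_memFormula]⟩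

/-- The right-hand side does not mention `B`; this is what makes the component 00 independent of
parameters from `G`. -/
theorem isTypeDefinableOver_iff [Group G] (i : G ↪ₑ[fullGroupLang G] M) {B : Set M}
    (hB : B ⊆ Set.range i) {X : Set M} :
    IsTypeDefinableOver (fullGroupLang G) B X ↔
      ∃ S : Set (Set G), X = {x | ∀ D ∈ S, x ∈ interpSet M D} := by
  constructor
  · rintro ⟨S, hS, rfl⟩
    refine ⟨{E | interpSet M E ∈ S}, Set.ext fun x => ⟨fun h D hD => h _ hD, fun h D hD => ?_⟩⟩
    obtain ⟨E, rfl⟩ := exists_eq_interpSet_of_definable i hB (hS D hD)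
    exact h E hD
  · rintro ⟨S, rfl⟩
    refine ⟨interpSet M '' S, ?_, ?_⟩
    · rintro _ ⟨D, -, rfl⟩
      exact definable_interpSet B D
    · ext x
      simp

theorem isInvariantOver_iff [Group G] (i : G ↪ₑ[fullGroupLang G] M) {B : Set M}
    (hB : B ⊆ Set.range i) {X : Set M} :
    IsInvariantOver (fullGroupLang G) B X ↔
      ∀ σ : M ≃[fullGroupLang G] M, σ '' X = X := by
  refine ⟨fun h σ => h σ fun b hb => ?_, fun h σ _ => h σ⟩
  obtain ⟨g, rfl⟩ := hB hb
  have h1 : σ (i g) ∈ interpSet M {g} := (apply_mem_interpSet_iff σ).2 ((apply_mem_interpSet i).2 rfl)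
  -- In `G` the formula `x = g` defines `{g}`, so the predicate for `{g}` holds in `M` of `i g`
  -- alone.
  have h2 := realize_iff_mem_interpSet i (α := Unit) (FirstOrder.Language.Term.equal
    (L := fullGroupLang G) (.var (.inr 0)) (.var (.inl ()))) (fun _ => g) (σ (i g))
  simp only [FirstOrder.Language.Formula.realize_equal, FirstOrder.Language.Term.realize_var,
    Sum.elim_inr, Sum.elim_inl] at h2
  exact h2.2 h1

end Stars

/-! ### Types, coheirs and conjugate pairs -/

section Types

theorem IsSaturatedModel.exists_realize {L : FirstOrder.Language.{u, v}} {M : Type w}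
    [L.Structure M] {κ : Cardinal.{w}} (hM : IsSaturatedModel L M κ) {A : Set M} (hA : #A < κ)
    (p : Set (L.Formula (A ⊕ Fin 1)))
    (hp : ∀ q ⊆ p, q.Finite → ∃ a : M, ∀ φ ∈ q, φ.Realize (Sum.elim (fun b : A => (b : M)) fun _ => a)) :
    ∃ a : M, ∀ φ ∈ p, φ.Realize (Sum.elim (fun b : A => (b : M)) fun _ => a) := by
  have key (φ : L[[A]].Formula (Fin 1)) (a : M) :
      FirstOrder.Language.Formula.Realize (L := L)
        (FirstOrder.Language.BoundedFormula.constantsVarsEquiv φ)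
        (Sum.elim (fun b : A => (b : M)) fun _ => a) ↔ φ.Realize fun _ => a :=
    FirstOrder.Language.BoundedFormula.realize_constantsVarsEquiv
  let e : L[[A]].Formula (Fin 1) ≃ L.Formula (A ⊕ Fin 1) :=
    FirstOrder.Language.BoundedFormula.constantsVarsEquiv
  obtain ⟨a, ha⟩ := hM A hA (e ⁻¹' p) fun q hq hfin => by
    obtain ⟨a, ha⟩ := hp (e '' q) (Set.image_subset_iff.2 hq) (hfin.image _)
    exact ⟨a, fun φ hφ => (key φ a).1 (ha _ ⟨φ, hφ, rfl⟩)⟩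
  refine ⟨a, fun φ hφ => ?_⟩
  have h1 := (key (e.symm φ) a).2 (ha _ (by simpa using hφ))
  have h2 : e (e.symm φ) = φ := e.apply_symm_apply φ
  rwa [← h2]

variable {G : Type u} {M : Type w} [(fullGroupLang G).Structure M] {κ : Cardinal.{w}}

theorem IsMonster.aleph0_lt (hM : IsMonster (fullGroupLang G) M κ) : ℵ₀ < κ := by
  have h1 := hM.large
  have h2 : ℵ₀ < (2 : Cardinal.{u}) ^ max ℵ₀ (fullGroupLang G).card :=
    (Cardinal.cantor ℵ₀).trans_le (Cardinal.power_le_power_left two_ne_zero (le_max_left _ _))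
  have h3 := (Cardinal.lift_lt.{u, w}.2 h2).trans h1
  rw [Cardinal.lift_aleph0, Cardinal.aleph0_lt_lift] at h3
  exact h3

/-- Every finitely satisfiable family of predicates is realized. -/
theorem exists_forall_mem_interpSet (hM : IsMonster (fullGroupLang G) M κ) (S : Set (Set G))
    (hS : ∀ T ⊆ S, T.Finite → ∃ x : M, ∀ D ∈ T, x ∈ interpSet M D) :
    ∃ x : M, ∀ D ∈ S, x ∈ interpSet M D := by
  have h0 : #(∅ : Set M) < κ := by
    rw [Cardinal.mk_eq_zero]
    exact Cardinal.aleph0_pos.trans hM.aleph0_lt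
  let f : Set G → (fullGroupLang G).Formula ((∅ : Set M) ⊕ Fin 1) :=
    fun D => memFormula D (.var (.inr 0))
  obtain ⟨x, hx⟩ := hM.saturated.exists_realize h0 (f '' S) fun q hq hfin => by
    obtain ⟨T, hT, hTfin, rfl⟩ := Set.exists_subset_image_finite_and.1 ⟨q, hq, hfin, rfl⟩
    obtain ⟨x, hx⟩ := hS T hT hTfin
    refine ⟨x, ?_⟩
    rintro _ ⟨D, hD, rfl⟩
    exact (realize_memFormula _ _ _).2 (hx D hD)
  exact ⟨x, fun D hD => (realize_memFormula _ _ _).1 (hx _ ⟨D, hD, rfl⟩)⟩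

/-- `a` and `b` have the same type over `∅`. -/
def SameType (G : Type u) {M : Type w} [(fullGroupLang G).Structure M] (a b : M) : Prop :=
  ∀ D : Set G, a ∈ interpSet M D ↔ b ∈ interpSet M D

variable [Group G] (i : G ↪ₑ[fullGroupLang G] M)

/-- `c` realizes over `A` the heir of the type of `a` that is finitely satisfiable in `G`. -/
def IsCoheir (A : Set M) (a c : M) : Prop :=
  ∀ φ : (fullGroupLang G).Formula (A ⊕ Fin 1),
    φ.Realize (Sum.elim (fun b : A => (b : M)) fun _ => c) ↔
      a ∈ interpSet M {g : G | φ.Realize (Sum.elim (fun b : A => (b : M)) fun _ => i g)}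

variable {i}

/-- Finitely many sets in the type of `a` have an intersection that is nonempty in `G`, so the
required type is finitely satisfiable, already by elements of `G`. It is complete because
complements are named too. -/
theorem exists_isCoheir (hM : IsMonster (fullGroupLang G) M κ) {A : Set M} (hA : #A < κ) (a : M) :
    ∃ c, IsCoheir i A a c := by
  let E (φ : (fullGroupLang G).Formula (A ⊕ Fin 1)) : Set G :=
    {g : G | φ.Realize (Sum.elim (fun b : A => (b : M)) fun _ => i g)}
  obtain ⟨c, hc⟩ := hM.saturated.exists_realize hA {φ | a ∈ interpSet M (E φ)} fun q hq hfin => by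
    have h1 : a ∈ interpSet M (⋂₀ (E '' q)) := by
      rw [mem_interpSet_sInter i (hfin.image E)]
      rintro _ ⟨φ, hφ, rfl⟩
      exact hq hφ
    obtain ⟨g, hg⟩ := nonempty_of_mem_interpSet i h1
    exact ⟨i g, fun φ hφ => hg _ ⟨φ, hφ, rfl⟩⟩
  refine ⟨c, fun φ => ⟨fun h => ?_, hc φ⟩⟩
  by_contra h'
  have h2 : a ∈ interpSet M (E φ.not) := by
    rw [← Set.mem_compl_iff, ← interpSet_compl i] at h'
    exact h'
  exact hc _ h2 h

theorem IsCoheir.sameType {A : Set M} {a c : M} (h : IsCoheir i A a c) : SameType G a c :=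
  fun D => by
    have := h (memFormula D (.var (.inr 0)))
    simp only [realize_memFormula, FirstOrder.Language.Term.realize_var, Sum.elim_inr,
      apply_mem_interpSet i] at this
    exact this.symm

/-- A pair `(r, c)` with `c` a coheir over `r` of the type of `r` has a type determined by that of
`r`. -/
theorem IsCoheir.realize_iff {A A' : Set M} {r r' c c' : M} (h : IsCoheir i A r c)
    (h' : IsCoheir i A' r' c') (hr : r ∈ A) (hr' : r' ∈ A') (hrr : SameType G r r')
    (φ : (fullGroupLang G).Formula (Fin 2)) : φ.Realize ![r, c] ↔ φ.Realize ![r', c'] := by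
  -- For `g` in `G`, the condition on `r` that `φ` holds of `r` and `i g` is a predicate. The coheir
  -- condition turns `φ` at `(r, c)` into iterated membership in the type of `r`.
  have key {A : Set M} {r c : M} (h : IsCoheir i A r c) (hr : r ∈ A) :
      φ.Realize ![r, c] ↔ r ∈ interpSet M {g : G | r ∈ interpSet M {k : G | φ.Realize ![k, g]}} := by
    have h1 := h (φ.relabel ![Sum.inl ⟨r, hr⟩, Sum.inr 0])
    have hv (x : M) : (Sum.elim (fun b : A => (b : M)) fun _ => x) ∘
        ![Sum.inl ⟨r, hr⟩, Sum.inr (0 : Fin 1)] = ![r, x] := by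
      ext k; fin_cases k <;> rfl
    simp only [FirstOrder.Language.Formula.realize_relabel, hv] at h1
    rw [h1]
    have h2 (g : G) : φ.Realize ![r, i g] ↔ r ∈ interpSet M {k : G | φ.Realize ![k, g]} := by
      have h3 := realize_iff_mem_interpSet i (α := Unit) (φ.relabel ![Sum.inr 0, Sum.inl ()])
        (fun _ => g) r
      have e1 : (Sum.elim (i ∘ fun _ : Unit => g) fun _ => r) ∘ ![Sum.inr (0 : Fin 1), Sum.inl ()]
          = ![r, i g] := by
        ext k; fin_cases k <;> rfl
      have e2 (k : G) : (Sum.elim (fun _ : Unit => g) fun _ => k) ∘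
          ![Sum.inr (0 : Fin 1), Sum.inl ()] = ![k, g] := by
        ext k; fin_cases k <;> rfl
      simp only [FirstOrder.Language.Formula.realize_relabel, e1, e2] at h3
      exact h3
    simp only [h2]
  rw [key h hr, key h' hr', hrr]
  simp only [hrr _]

theorem IsCoheir.exists_equiv (hM : IsMonster (fullGroupLang G) M κ) {A A' : Set M} {r r' c c' : M}
    (h : IsCoheir i A r c) (h' : IsCoheir i A' r' c') (hr : r ∈ A) (hr' : r' ∈ A')
    (hrr : SameType G r r') : ∃ σ : M ≃[fullGroupLang G] M, σ r = r' ∧ σ c = c' := by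
  classical
  have key := h.realize_iff h' hr hr' hrr
  let g : ({r, c} : Set M) → Fin 2 := fun a => if (a : M) = r then 0 else 1
  have hg : ![r, c] ∘ g = fun a : ({r, c} : Set M) => (a : M) := by
    funext ⟨a, ha⟩
    by_cases har : a = r
    · simp [g, har]
    · simpa [g, har] using (ha.resolve_left har : a = c).symm
  obtain ⟨σ, hσ⟩ := hM.homogeneous ({r, c} : Set M)
    ((Cardinal.lt_aleph0_iff_set_finite.2 (Set.toFinite _)).trans hM.aleph0_lt) (![r', c'] ∘ g)
    fun φ => by
      rw [← hg, ← FirstOrder.Language.Formula.realize_relabel,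
        ← FirstOrder.Language.Formula.realize_relabel, key]
  refine ⟨σ, (hσ ⟨r, by simp⟩).trans (by simp [g]), (hσ ⟨c, by simp⟩).trans ?_⟩
  -- If `c = r`, then `g` sends both to index 0, and `c' = r'` must come from the formula `x₀ = x₁`.
  by_cases hcr : c = r
  · have := key (FirstOrder.Language.Term.equal (L := fullGroupLang G) (.var 0) (.var 1))
    simp only [FirstOrder.Language.Formula.realize_equal, FirstOrder.Language.Term.realize_var] at this
    simpa [g, hcr] using this.1 hcr.symm
  · simp [g, hcr]

end Types

/-! ### Invariant subgroups of bounded index and existence of the components -/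

section BoundedSubgroups

/-- The group `M` carries the operations interpreting the group symbols. -/
structure IsInterpretedGroup (G : Type u) (M : Type w) [(fullGroupLang G).Structure M]
    [Group M] : Prop where
  mul_eq : ∀ x y : M, x * y = interpMul G x y
  inv_eq : ∀ x : M, x⁻¹ = interpInv G x

variable {G : Type u} {M : Type w} [(fullGroupLang G).Structure M] [Group M] {κ : Cardinal.{w}}

theorem IsInterpretedGroup.mul_mem_interpSet [Group G] (hG : IsInterpretedGroup G M)
    (i : G ↪ₑ[fullGroupLang G] M) {D E C : Set G} (h : ∀ g ∈ D, ∀ g' ∈ E, g * g' ∈ C) {x y : M}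
    (hx : x ∈ interpSet M D) (hy : y ∈ interpSet M E) : x * y ∈ interpSet M C :=
  hG.mul_eq x y ▸ interpMul_mem_interpSet i h hx hy

theorem IsInterpretedGroup.inv_mem_interpSet [Group G] (hG : IsInterpretedGroup G M)
    (i : G ↪ₑ[fullGroupLang G] M) {D C : Set G} (h : ∀ g ∈ D, g⁻¹ ∈ C) {x : M}
    (hx : x ∈ interpSet M D) : x⁻¹ ∈ interpSet M C :=
  hG.inv_eq x ▸ interpInv_mem_interpSet i h hx

theorem IsInterpretedGroup.one_mem_interpSet [Group G] (hG : IsInterpretedGroup G M)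
    (i : G ↪ₑ[fullGroupLang G] M) {D : Set G} (h : 1 ∈ D) : (1 : M) ∈ interpSet M D := by
  have h1 : i 1 ∈ interpSet M ({1} : Set G) := (apply_mem_interpSet i).2 rfl
  have h2 := hG.mul_mem_interpSet i (C := D) (by simpa using h) (hG.inv_mem_interpSet i
    (C := {1}) (by simp) h1) h1
  rwa [inv_mul_cancel] at h2

theorem IsInterpretedGroup.apply_inv_mul (hG : IsInterpretedGroup G M)
    (σ : M ≃[fullGroupLang G] M) (x y : M) : σ (x⁻¹ * y) = (σ x)⁻¹ * σ y := by
  rw [hG.mul_eq, hG.inv_eq, hG.mul_eq, hG.inv_eq, apply_interpMul, apply_interpInv]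

/-- Elements of the same type lie in the same coset of an invariant subgroup of bounded index. -/
theorem inv_mul_mem_of_sameType [Group G] (i : G ↪ₑ[fullGroupLang G] M)
    (hG : IsInterpretedGroup G M) (hM : IsMonster (fullGroupLang G) M κ) {H : Subgroup M}
    (hH : ∀ σ : M ≃[fullGroupLang G] M, σ '' H = H) (hκ : HasBoundedIndex κ H) {a b : M}
    (hab : SameType G a b) : a⁻¹ * b ∈ H := by
  classical
  -- One realization of the type of `a` is chosen in each coset that has one; the default `a` keeps
  -- every value of `f` in that type.
  let f : M ⧸ H → M := fun q => if h : ∃ r : M, (r : M ⧸ H) = q ∧ SameType G r a then h.choose else a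
  have hf (q : M ⧸ H) : SameType G (f q) a := by
    by_cases h : ∃ r : M, (r : M ⧸ H) = q ∧ SameType G r a
    · simp only [f, dif_pos h]
      exact h.choose_spec.2
    · simp only [f, dif_neg h]
      exact fun _ => Iff.rfl
  -- Bounded index makes the set of representatives small. The coset of `c` has its representative
  -- `r` among the parameters, so one coheir pair `(r, c)` satisfies `r⁻¹ * c ∈ H`.
  obtain ⟨c, hc⟩ := exists_isCoheir (i := i) hM (Cardinal.mk_range_le.trans_lt hκ :
    #(Set.range f) < κ) a
  have hca : ∃ r : M, (r : M ⧸ H) = (c : M ⧸ H) ∧ SameType G r a :=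
    ⟨c, rfl, fun D => (hc.sameType D).symm⟩
  set r := f (c : M ⧸ H) with hr
  have hrc : r⁻¹ * c ∈ H := by
    rw [← QuotientGroup.eq, hr]
    simp only [f, dif_pos hca]
    exact hca.choose_spec.1
  obtain ⟨d, hd⟩ := exists_isCoheir (i := i) hM
    ((Cardinal.lt_aleph0_iff_set_finite.2 (Set.toFinite ({a, b} : Set M))).trans hM.aleph0_lt) a
  -- Both `(a, d)` and `(b, d)` are conjugate to `(r, c)`, so `a⁻¹ * d` and `b⁻¹ * d` lie in `H`.
  have key (e : M) (he : e ∈ ({a, b} : Set M)) (hea : SameType G a e) : e⁻¹ * d ∈ H := by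
    have hc' : IsCoheir i (Set.range f) r c := fun φ => (hc φ).trans (hf _ _).symm
    have hd' : IsCoheir i {a, b} e d := fun φ => (hd φ).trans (hea _)
    obtain ⟨σ, rfl, rfl⟩ := hc'.exists_equiv hM hd' ⟨_, rfl⟩ he
      fun D => (hf _ D).trans (hea D)
    rw [← hG.apply_inv_mul]
    have : σ (r⁻¹ * c) ∈ σ '' (H : Set M) := ⟨_, hrc, rfl⟩
    rwa [hH σ] at this
  have h1 := H.mul_mem (key a (by simp) fun _ => Iff.rfl) (H.inv_mem (key b (by simp) hab))
  simpa [mul_assoc] using h1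

/-- A coset is determined by the type of a representative. There are at most `2 ^ |L|` types, since
`L` has a symbol for every subset of `G`. -/
theorem hasBoundedIndex_of_forall_sameType (hM : IsMonster (fullGroupLang G) M κ)
    {H : Subgroup M} (hH : ∀ a b : M, SameType G a b → a⁻¹ * b ∈ H) : HasBoundedIndex κ H := by
  let f : M ⧸ H → Set (Set G) := fun q => {D | q.out ∈ interpSet M D}
  have hf : Function.Injective f := fun p q hpq => by
    rw [← QuotientGroup.out_eq' p, ← QuotientGroup.out_eq' q, QuotientGroup.eq]
    exact hH _ _ fun D => Set.ext_iff.1 hpq D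
  have h1 := Cardinal.mk_le_of_injective (α := ULift.{u} (M ⧸ H)) (β := ULift.{w} (Set (Set G)))
    (f := fun q => ⟨f q.down⟩) fun p q h => ULift.ext _ _ (hf (ULift.up_injective h))
  rw [Cardinal.mk_uLift, Cardinal.mk_uLift] at h1
  have h2 : #(Set G) ≤ (fullGroupLang G).card :=
    Cardinal.mk_le_of_injective (f := fun D => Sum.inr ⟨1, SubsetRel.pred D⟩) fun D E h => by
      cases Sum.inr_injective h
      rfl
  have h3 : #(Set (Set G)) ≤ 2 ^ max ℵ₀ (fullGroupLang G).card := by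
    rw [Cardinal.mk_set]
    exact Cardinal.power_le_power_left two_ne_zero (h2.trans (le_max_right _ _))
  exact Cardinal.lift_lt.1 ((h1.trans (Cardinal.lift_le.2 h3)).trans_lt hM.large)

theorem isLeast_component000 [Group G] (i : G ↪ₑ[fullGroupLang G] M)
    (hG : IsInterpretedGroup G M) (hM : IsMonster (fullGroupLang G) M κ) {B : Set M}
    (hB : B ⊆ Set.range i) :
    IsLeast (invariantBounded (fullGroupLang G) κ B) (component000 (fullGroupLang G) κ B) := by
  refine ⟨⟨(isInvariantOver_iff i hB).2 fun σ => ?_, ?_⟩, fun H hH => sInf_le hH⟩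
  · have h (τ : M ≃[fullGroupLang G] M) {x : M} (hx : x ∈ component000 (fullGroupLang G) κ B) :
        τ x ∈ component000 (fullGroupLang G) κ B := by
      refine Subgroup.mem_sInf.2 fun H hH => ?_
      have h1 : τ x ∈ τ '' (H : Set M) := ⟨x, Subgroup.mem_sInf.1 hx H hH, rfl⟩
      rwa [(isInvariantOver_iff i hB).1 hH.1 τ] at h1
    refine Set.Subset.antisymm ?_ fun x hx => ⟨σ.symm x, h _ hx, σ.apply_symm_apply x⟩
    rintro _ ⟨x, hx, rfl⟩
    exact h σ hx
  · refine hasBoundedIndex_of_forall_sameType hM fun a b hab => Subgroup.mem_sInf.2 fun H hH => ?_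
    exact inv_mul_mem_of_sameType i hG hM ((isInvariantOver_iff i hB).1 hH.1) hH.2 hab

theorem typeDefinableBounded_subset [Group G] (i : G ↪ₑ[fullGroupLang G] M) {B : Set M}
    (hB : B ⊆ Set.range i) :
    typeDefinableBounded (fullGroupLang G) κ B ⊆ invariantBounded (fullGroupLang G) κ B := by
  rintro H ⟨h1, h2⟩
  obtain ⟨S, hS⟩ := (isTypeDefinableOver_iff i hB).1 h1
  refine ⟨(isInvariantOver_iff i hB).2 fun σ => ?_, h2⟩
  ext x
  obtain ⟨y, rfl⟩ := σ.surjective x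
  rw [σ.injective.mem_set_image, hS]
  simp only [Set.mem_ofPred_eq, apply_mem_interpSet_iff]

theorem isLeast_component00 [Group G] (i : G ↪ₑ[fullGroupLang G] M)
    (hG : IsInterpretedGroup G M) (hM : IsMonster (fullGroupLang G) M κ) {B : Set M}
    (hB : B ⊆ Set.range i) :
    IsLeast (typeDefinableBounded (fullGroupLang G) κ B) (component00 (fullGroupLang G) κ B) := by
  refine ⟨⟨(isTypeDefinableOver_iff i hB).2
    -- The largest possible family of predicates: it includes those defining each of the intersected
    -- subgroups.
    ⟨{D | (component00 (fullGroupLang G) κ B : Set M) ⊆ interpSet M D}, ?_⟩, ?_⟩,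
    fun H hH => sInf_le hH⟩
  · refine Set.Subset.antisymm (fun x hx D hD => hD hx) fun x hx => Subgroup.mem_sInf.2 fun H hH => ?_
    obtain ⟨S, hS⟩ := (isTypeDefinableOver_iff i hB).1 hH.1
    rw [← SetLike.mem_coe, hS]
    refine fun D hD => hx D fun y hy => ?_
    have hyH : y ∈ (H : Set M) := Subgroup.mem_sInf.1 hy H hH
    rw [hS] at hyH
    exact hyH D hD
  · refine hasBoundedIndex_of_forall_sameType hM fun a b hab => Subgroup.mem_sInf.2 fun H hH => ?_
    have hH' := typeDefinableBounded_subset i hB hH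
    exact inv_mul_mem_of_sameType i hG hM ((isInvariantOver_iff i hB).1 hH'.1) hH.2 hab

theorem component000_eq [Group G] (i : G ↪ₑ[fullGroupLang G] M) {B : Set M}
    (hB : B ⊆ Set.range i) :
    component000 (fullGroupLang G) κ B = component000 (fullGroupLang G) κ (∅ : Set M) := by
  have : invariantBounded (fullGroupLang G) κ B =
      invariantBounded (fullGroupLang G) κ (∅ : Set M) := Set.ext fun H => by
    simp only [invariantBounded, Set.mem_ofPred_eq, isInvariantOver_iff i hB,
      isInvariantOver_iff i (Set.empty_subset _)]
  rw [component000, component000, this]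

theorem component00_eq [Group G] (i : G ↪ₑ[fullGroupLang G] M) {B : Set M}
    (hB : B ⊆ Set.range i) :
    component00 (fullGroupLang G) κ B = component00 (fullGroupLang G) κ (∅ : Set M) := by
  have : typeDefinableBounded (fullGroupLang G) κ B =
      typeDefinableBounded (fullGroupLang G) κ (∅ : Set M) := Set.ext fun H => by
    simp only [typeDefinableBounded, Set.mem_ofPred_eq, isTypeDefinableOver_iff i hB,
      isTypeDefinableOver_iff i (Set.empty_subset _)]
  rw [component00, component00, this]

end BoundedSubgroups

/-! ### Circle homeomorphisms, ping-pong and a quasimorphism -/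

section CircleMaps

/-- The lift of a circle map that fixes the base point and acts on the fundamental domain `[0, 1)`
by the monotone function `p`. -/
noncomputable def blockLift (p : ℝ → ℝ) (hp : Monotone p) (h0 : p 0 = 0) (h1 : p 1 = 1) : CircleDeg1Lift where
  toFun x := ⌊x⌋ + p (Int.fract x)
  monotone' x y hxy := by
    rcases (Int.floor_mono hxy).eq_or_lt with h | h
    · have : Int.fract x ≤ Int.fract y := by
        unfold Int.fract
        rw [h]
        linarith
      show (⌊x⌋ : ℝ) + _ ≤ ⌊y⌋ + _
      rw [h]
      exact add_le_add_right (hp this) _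
    · have h2 : p (Int.fract x) ≤ 1 := h1 ▸ hp (Int.fract_lt_one x).le
      have h3 : 0 ≤ p (Int.fract y) := h0 ▸ hp (Int.fract_nonneg y)
      have h4 : ((⌊x⌋ : ℤ) : ℝ) + 1 ≤ (⌊y⌋ : ℤ) := by exact_mod_cast h
      show (⌊x⌋ : ℝ) + _ ≤ ⌊y⌋ + _
      linarith
  map_add_one' x := by
    rw [Int.floor_add_one, Int.fract_add_one]
    push_cast
    ring

theorem blockLift_mul {p p' : ℝ → ℝ} {hp : Monotone p} {h0 : p 0 = 0} {h1 : p 1 = 1}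
    {hp' : Monotone p'} {h0' : p' 0 = 0} {h1' : p' 1 = 1} (h : ∀ t, p (p' t) = t) :
    blockLift p hp h0 h1 * blockLift p' hp' h0' h1' = 1 := by
  ext x
  -- A value 1 would give `Int.fract x = p 1 = 1`. So `p'` preserves `[0, 1)` and the integer part
  -- is unchanged.
  have hlt : p' (Int.fract x) < 1 := by
    refine lt_of_le_of_ne (h1' ▸ hp' (Int.fract_lt_one x).le) fun h2 => ?_
    have := h (Int.fract x)
    rw [h2, h1] at this
    exact (Int.fract_lt_one x).ne this.symm
  have hge : 0 ≤ p' (Int.fract x) := h0' ▸ hp' (Int.fract_nonneg x)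
  have h3 : ⌊(⌊x⌋ : ℝ) + p' (Int.fract x)⌋ = ⌊x⌋ := by
    rw [Int.floor_intCast_add, Int.floor_eq_zero_iff.2 ⟨hge, hlt⟩, add_zero]
  show ((⌊(⌊x⌋ : ℝ) + p' (Int.fract x)⌋ : ℤ) : ℝ) + p (Int.fract (⌊x⌋ + p' (Int.fract x))) = x
  rw [h3, Int.fract_intCast_add, Int.fract_eq_self.2 ⟨hge, hlt⟩, h, Int.floor_add_fract]

/-- A circle homeomorphism fixing `0` and pushing `1/4` beyond `3/4`. -/
noncomputable def pushUnit : CircleDeg1Liftˣ where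
  -- The graph joins (0, 0), (1/4, 3/4) and (1, 1) by segments.
  val := blockLift (fun t => min (3 * t) ((t + 2) / 3))
    (fun s t h => min_le_min (by linarith) (by linarith)) (by norm_num) (by norm_num)
  inv := blockLift (fun t => max (t / 3) (3 * t - 2))
    (fun s t h => max_le_max (by linarith) (by linarith)) (by norm_num) (by norm_num)
  val_inv := blockLift_mul fun t => by
    rcases le_total (t / 3) (3 * t - 2) with h | h
    · rw [max_eq_right h, min_eq_right (by linarith)]; ring
    · rw [max_eq_left h, min_eq_left (by linarith)]; ring
  inv_val := blockLift_mul fun t => by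
    rcases le_total (3 * t) ((t + 2) / 3) with h | h
    · rw [min_eq_left h, max_eq_left (by linarith)]; ring
    · rw [min_eq_right h, max_eq_right (by linarith)]; ring

theorem pushUnit_apply {x : ℝ} (h0 : 0 ≤ x) (h1 : x < 1) :
    (pushUnit : CircleDeg1Lift) x = min (3 * x) ((x + 2) / 3) := by
  show ((⌊x⌋ : ℤ) : ℝ) + min (3 * Int.fract x) ((Int.fract x + 2) / 3) = _
  rw [Int.floor_eq_zero_iff.2 ⟨h0, h1⟩, Int.fract_eq_self.2 ⟨h0, h1⟩, Int.cast_zero, zero_add]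

/-- The conjugate of `pushUnit` by the half turn. -/
noncomputable def pushUnit' : CircleDeg1Liftˣ :=
  CircleDeg1Lift.translate (Multiplicative.ofAdd (1 / 2)) * pushUnit *
    (CircleDeg1Lift.translate (Multiplicative.ofAdd (1 / 2)))⁻¹

theorem pushUnit_pow_zero (k : ℕ) : ((pushUnit ^ k : CircleDeg1Liftˣ) : CircleDeg1Lift) 0 = 0 := by
  induction k with
  | zero => rfl
  | succ k ih =>
    rw [pow_succ', Units.val_mul, CircleDeg1Lift.mul_apply, ih,
      pushUnit_apply le_rfl zero_lt_one]
    norm_num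

theorem pushUnit_pow_quarter (k : ℕ) :
    3 / 4 ≤ ((pushUnit ^ (k + 1) : CircleDeg1Liftˣ) : CircleDeg1Lift) (1 / 4) := by
  have h : (pushUnit : CircleDeg1Lift) (1 / 4) = 3 / 4 := by
    rw [pushUnit_apply (by norm_num) (by norm_num)]; norm_num
  induction k with
  | zero => rw [zero_add, pow_one, h]
  | succ k ih =>
    rw [pow_succ', Units.val_mul, CircleDeg1Lift.mul_apply, ← h]
    exact (pushUnit : CircleDeg1Lift).monotone (by linarith)

theorem pushUnit'_pow_apply (k : ℕ) (x : ℝ) :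
    ((pushUnit' ^ k : CircleDeg1Liftˣ) : CircleDeg1Lift) x =
      1 / 2 + ((pushUnit ^ k : CircleDeg1Liftˣ) : CircleDeg1Lift) (-(1 / 2) + x) := by
  rw [pushUnit', conj_pow, Units.val_mul, Units.val_mul, CircleDeg1Lift.mul_apply,
    CircleDeg1Lift.mul_apply, CircleDeg1Lift.translate_inv_apply, CircleDeg1Lift.translate_apply]

/-- Ping-pong: positive powers of `pushUnit'` send `[n - 1/4, n]` into `[n + 1/4, n + 1/2]`, and
positive powers of `pushUnit` send that into `[n + 3/4, n + 1]`. Uniformity in the exponents is what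
allows nonstandard powers later. -/
theorem push_step (j k n : ℕ) {x : ℝ} (h1 : n - 1 / 4 ≤ x) (h2 : x ≤ n) :
    ((n + 1 : ℕ) : ℝ) - 1 / 4 ≤ ((pushUnit ^ (j + 1) : CircleDeg1Liftˣ) : CircleDeg1Lift)
        (((pushUnit' ^ (k + 1) : CircleDeg1Liftˣ) : CircleDeg1Lift) x) ∧
      ((pushUnit ^ (j + 1) : CircleDeg1Liftˣ) : CircleDeg1Lift)
        (((pushUnit' ^ (k + 1) : CircleDeg1Liftˣ) : CircleDeg1Lift) x) ≤ ((n + 1 : ℕ) : ℝ) := by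
  set A : CircleDeg1Lift := ((pushUnit ^ (j + 1) : CircleDeg1Liftˣ) : CircleDeg1Lift) with hA
  set C : CircleDeg1Lift := ((pushUnit ^ (k + 1) : CircleDeg1Liftˣ) : CircleDeg1Lift) with hC
  rw [pushUnit'_pow_apply, ← hC]
  have a0 : A 0 = 0 := pushUnit_pow_zero _
  have c0 : C 0 = 0 := pushUnit_pow_zero _
  have aq : 3 / 4 ≤ A (1 / 4) := pushUnit_pow_quarter _
  have cq : 3 / 4 ≤ C (1 / 4) := pushUnit_pow_quarter _
  have e1 : C (1 / 4 + ((n : ℤ) - 1 : ℤ)) = C (1 / 4) + ((n : ℤ) - 1 : ℤ) := C.map_add_int _ _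
  have e2 : C (0 + (n : ℕ)) = C 0 + (n : ℕ) := C.map_add_nat _ _
  have e3 : A (1 / 4 + (n : ℕ)) = A (1 / 4) + (n : ℕ) := A.map_add_nat _ _
  have e4 : A (0 + (n + 1 : ℕ)) = A 0 + (n + 1 : ℕ) := A.map_add_nat _ _
  push_cast at e1 e2 e3 e4 ⊢
  have b1 : C (1 / 4 + (n - 1)) ≤ C (-(1 / 2) + x) := C.monotone (by linarith)
  have b2 : C (-(1 / 2) + x) ≤ C (0 + n) := C.monotone (by linarith)
  have b3 : A (1 / 4 + n) ≤ A (1 / 2 + C (-(1 / 2) + x)) := A.monotone (by linarith)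
  have b4 : A (1 / 2 + C (-(1 / 2) + x)) ≤ A (0 + (n + 1)) := A.monotone (by linarith)
  constructor <;> linarith

/-- The quasimorphism attached to an action on the circle by lifts. -/
noncomputable def ceilZero {F : Type u} [Group F] (ρ : F →* CircleDeg1Liftˣ) (g : F) : ℤ :=
  ⌈(ρ g : CircleDeg1Lift) 0⌉

variable {F : Type u} [Group F] (ρ : F →* CircleDeg1Liftˣ)

theorem ceilZero_one : ceilZero ρ 1 = 0 := by
  rw [ceilZero, map_one, Units.val_one, CircleDeg1Lift.coe_one, id, Int.ceil_zero]

/-- Monotonicity bounds the left side above using the ceiling of `ρ h` at 0 and below using its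
floor, and these differ by at most 1. -/
theorem ceilZero_mul (g h : F) : ceilZero ρ (g * h) = ceilZero ρ g + ceilZero ρ h ∨
    ceilZero ρ (g * h) = ceilZero ρ g + ceilZero ρ h - 1 := by
  have h1 := (ρ g : CircleDeg1Lift).ceil_map_map_zero_le (ρ h)
  have h2 := (ρ g : CircleDeg1Lift).le_ceil_map_map_zero (ρ h)
  have h3 := Int.ceil_le_floor_add_one ((ρ h : CircleDeg1Lift) 0)
  rw [CircleDeg1Lift.mul_apply] at h2
  have h4 : ceilZero ρ (g * h) = ⌈(ρ g : CircleDeg1Lift) ((ρ h : CircleDeg1Lift) 0)⌉ := by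
    rw [ceilZero, map_mul, Units.val_mul, CircleDeg1Lift.mul_apply]
  rw [h4]
  unfold ceilZero
  omega

end CircleMaps

/-! ### The invariant subgroup of elements with integral 3-adic residue -/

section ResidueSubgroup

/-- The elements on which the quasimorphism is congruent to `n` modulo `3 ^ k`. -/
def residueSet {F : Type u} [Group F] (ρ : F →* CircleDeg1Liftˣ) (k : ℕ) (n : ℤ) : Set F :=
  {g | ceilZero ρ g ≡ n [ZMOD 3 ^ k]}

variable {F : Type u} [Group F] (ρ : F →* CircleDeg1Liftˣ)

theorem residueSet_anti {k l : ℕ} (h : k ≤ l) (n : ℤ) : residueSet ρ l n ⊆ residueSet ρ k n :=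
  fun _ hg => Int.ModEq.of_dvd (pow_dvd_pow 3 h) hg

theorem mul_mem_residueSet {k : ℕ} {n n' : ℤ} {g g' : F} (hg : g ∈ residueSet ρ k n)
    (hg' : g' ∈ residueSet ρ k n') :
    g * g' ∈ residueSet ρ k (n + n') ∪ residueSet ρ k (n + n' - 1) := by
  have h : ceilZero ρ g + ceilZero ρ g' ≡ n + n' [ZMOD 3 ^ k] := Int.ModEq.add hg hg'
  rcases ceilZero_mul ρ g g' with h1 | h1
  · exact Or.inl (h1 ▸ h : ceilZero ρ (g * g') ≡ _ [ZMOD 3 ^ k])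
  · exact Or.inr (h1 ▸ h.sub_right 1 : ceilZero ρ (g * g') ≡ _ [ZMOD 3 ^ k])

theorem inv_mem_residueSet {k : ℕ} {n : ℤ} {g : F} (hg : g ∈ residueSet ρ k n) :
    g⁻¹ ∈ residueSet ρ k (-n) ∪ residueSet ρ k (1 - n) := by
  have hg' : ceilZero ρ g ≡ n [ZMOD 3 ^ k] := hg
  rcases ceilZero_mul ρ g g⁻¹ with h1 | h1 <;> rw [mul_inv_cancel, ceilZero_one] at h1
  · refine Or.inl (?_ : ceilZero ρ g⁻¹ ≡ _ [ZMOD 3 ^ k])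
    rw [show ceilZero ρ g⁻¹ = -ceilZero ρ g by omega]
    exact hg'.neg
  · refine Or.inr (?_ : ceilZero ρ g⁻¹ ≡ _ [ZMOD 3 ^ k])
    rw [show ceilZero ρ g⁻¹ = 1 - ceilZero ρ g by omega]
    exact Int.ModEq.sub_left 1 hg'

variable {ρ} {M : Type w} [(fullGroupLang F).Structure M]

/-- Pigeonhole: if each candidate failed at some level, all would fail at the largest of these
levels, because the residue sets shrink with `k`. It turns a bounded error at each level into a
single integer. -/
theorem exists_forall_mem_residueSet (i : F ↪ₑ[fullGroupLang F] M) (S : Finset ℤ) {z : M}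
    (h : ∀ k, ∃ n ∈ S, z ∈ interpSet M (residueSet ρ k n)) :
    ∃ n, ∀ k, z ∈ interpSet M (residueSet ρ k n) := by
  by_contra! hz
  choose f hf using hz
  obtain ⟨n, hn, hz⟩ := h (S.sup f)
  exact hf n (interpSet_mono i (residueSet_anti ρ (Finset.le_sup hn) n) hz)

theorem exists_mem_residueSet (i : F ↪ₑ[fullGroupLang F] M) (k : ℕ) (z : M) : ∃ n, z ∈ interpSet M (residueSet ρ k n) := by
  by_contra! hz
  have h1 : z ∈ interpSet M (⋂₀ ((fun n => (residueSet ρ k n)ᶜ) '' Set.Ico 0 (3 ^ k))) := by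
    rw [mem_interpSet_sInter i ((Set.finite_Ico _ _).image _)]
    rintro _ ⟨n, -, rfl⟩
    rw [interpSet_compl i]
    exact hz n
  obtain ⟨g, hg⟩ := nonempty_of_mem_interpSet i h1
  have h3 : (0 : ℤ) < 3 ^ k := by positivity
  exact hg _ ⟨ceilZero ρ g % 3 ^ k, ⟨Int.emod_nonneg _ h3.ne', Int.emod_lt_of_pos _ h3⟩, rfl⟩
    (Int.mod_modEq _ _).symm

variable [Group M] (ρ) (i : F ↪ₑ[fullGroupLang F] M)

/-- The elements whose image under the quasimorphism has the `3`-adic limit of an integer. -/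
def residueSubgroup (hG : IsInterpretedGroup F M) : Subgroup M where
  carrier := {z | ∃ n : ℤ, ∀ k, z ∈ interpSet M (residueSet ρ k n)}
  one_mem' := ⟨0, fun _ => hG.one_mem_interpSet i
    (by rw [residueSet, Set.mem_ofPred_eq, ceilZero_one])⟩
  mul_mem' := by
    rintro x y ⟨n, hn⟩ ⟨n', hn'⟩
    refine exists_forall_mem_residueSet i {n + n', n + n' - 1} fun k => ?_
    have h := hG.mul_mem_interpSet i (fun _ hg _ hg' => mul_mem_residueSet ρ hg hg')
      (hn k) (hn' k)
    rw [interpSet_union i] at h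
    simpa using h
  inv_mem' := by
    rintro x ⟨n, hn⟩
    refine exists_forall_mem_residueSet i {-n, 1 - n} fun k => ?_
    have h := hG.inv_mem_interpSet i (fun _ hg => inv_mem_residueSet ρ hg) (hn k)
    rw [interpSet_union i] at h
    simpa using h

/-- The common residue of `a` and `b` cancels at every level; inversion and multiplication leave an
error in `{-1, 0, 1}`. -/
theorem inv_mul_mem_residueSubgroup (hG : IsInterpretedGroup F M) {a b : M}
    (hab : SameType F a b) : a⁻¹ * b ∈ residueSubgroup ρ i hG := by
  refine exists_forall_mem_residueSet i {-1, 0, 1} fun k => ?_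
  obtain ⟨n, hn⟩ := exists_mem_residueSet (ρ := ρ) i k a
  have h := hG.inv_mem_interpSet i (fun _ hg => inv_mem_residueSet ρ hg) hn
  rw [interpSet_union i] at h
  have key {n' : ℤ} (h' : a⁻¹ ∈ interpSet M (residueSet ρ k n')) :
      a⁻¹ * b ∈ interpSet M (residueSet ρ k (n' + n)) ∪
        interpSet M (residueSet ρ k (n' + n - 1)) := by
    rw [← interpSet_union i]
    exact hG.mul_mem_interpSet i (fun _ hg _ hg' => mul_mem_residueSet ρ hg hg') h' ((hab _).1 hn)
  rcases h with h | h
  · have h1 := key h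
    rw [neg_add_cancel, zero_sub] at h1
    rcases h1 with h1 | h1
    · exact ⟨0, by simp, h1⟩
    · exact ⟨-1, by simp, h1⟩
  · have h1 := key h
    rw [sub_add_cancel, sub_self] at h1
    rcases h1 with h1 | h1
    · exact ⟨1, by simp, h1⟩
    · exact ⟨0, by simp, h1⟩

theorem residueSubgroup_mem_invariantBounded {κ : Cardinal.{w}} (hG : IsInterpretedGroup F M)
    (hM : IsMonster (fullGroupLang F) M κ) :
    residueSubgroup ρ i hG ∈ invariantBounded (fullGroupLang F) κ (∅ : Set M) := by
  refine ⟨fun σ _ => ?_, hasBoundedIndex_of_forall_sameType hM fun a b hab =>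
    inv_mul_mem_residueSubgroup ρ i hG hab⟩
  ext x
  obtain ⟨y, rfl⟩ := σ.surjective x
  rw [σ.injective.mem_set_image]
  exact exists_congr fun n => forall_congr' fun k => (apply_mem_interpSet_iff σ).symm

end ResidueSubgroup

/-! ### Separation of the two components by compactness -/

section Comparison

variable {F : Type u} [Group F] {M : Type w} [(fullGroupLang F).Structure M] [Group M] {κ : Cardinal.{w}}

/-- The difference of two elements of the same type can be a positive power of a given element. -/
theorem exists_sameType_inv_mul_mem_powers (i : F ↪ₑ[fullGroupLang F] M)
    (hG : IsInterpretedGroup F M)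
    (hM : IsMonster (fullGroupLang F) M κ) (u : F) :
    ∃ a c : M, SameType F c a ∧ c⁻¹ * a ∈ interpSet M {g : F | ∃ k : ℕ, g = u ^ (k + 1)} := by
  -- An element of all these tails is a power of `u` with exponent beyond every standard one.
  let T : ℕ → Set F := fun j => {g | ∃ k, j ≤ k ∧ g = u ^ k}
  obtain ⟨a, ha⟩ := exists_forall_mem_interpSet hM (Set.range T) fun S hS hfin => by
    choose! f hf using hS
    obtain ⟨N, hN⟩ := (hfin.image f).bddAbove
    refine ⟨i (u ^ N), fun D hD => (apply_mem_interpSet i).2 ?_⟩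
    rw [← hf hD]
    exact ⟨N, hN ⟨D, hD, rfl⟩, rfl⟩
  replace ha (j : ℕ) : a ∈ interpSet M (T j) := ha _ ⟨j, rfl⟩
  obtain ⟨c, hc⟩ := exists_isCoheir (i := i) hM
    ((Cardinal.lt_aleph0_iff_set_finite.2 (Set.toFinite ({a} : Set M))).trans hM.aleph0_lt) a
  refine ⟨a, c, fun D => (hc.sameType D).symm, ?_⟩
  have h := hc (memFormula {g : F | ∃ k : ℕ, g = u ^ (k + 1)}
    (mulTerm (invTerm (.var (.inr 0))) (.var (.inl ⟨a, rfl⟩))))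
  simp only [realize_memFormula, realize_mulTerm, realize_invTerm,
    FirstOrder.Language.Term.realize_var, Sum.elim_inr, Sum.elim_inl, ← hG.mul_eq,
    ← hG.inv_eq] at h
  -- By the coheir property it suffices to replace `c` by a standard `u ^ j`; since `a` lies in `T
  -- (j + 1)`, the remaining exponent is positive.
  refine h.2 (interpSet_mono i ?_ (ha 0))
  rintro _ ⟨j, -, rfl⟩
  have h1 := hG.inv_mem_interpSet i (D := {u ^ j}) (C := {(u ^ j)⁻¹}) (by simp)
    ((apply_mem_interpSet i).2 rfl)
  refine hG.mul_mem_interpSet i ?_ h1 (ha (j + 1))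
  rintro _ rfl _ ⟨k, hk, rfl⟩
  obtain ⟨l, rfl⟩ := Nat.exists_eq_add_of_le hk
  exact ⟨l, by rw [inv_mul_eq_iff_eq_mul, ← pow_add]; congr 1; omega⟩

theorem exists_mem_component000_powers (i : F ↪ₑ[fullGroupLang F] M)
    (hG : IsInterpretedGroup F M)
    (hM : IsMonster (fullGroupLang F) M κ) (u : F) :
    ∃ x ∈ component000 (fullGroupLang F) κ (∅ : Set M),
      x ∈ interpSet M {g : F | ∃ k : ℕ, g = u ^ (k + 1)} := by
  obtain ⟨a, c, hac, h⟩ := exists_sameType_inv_mul_mem_powers i hG hM u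
  have hl := (isLeast_component000 i hG hM (Set.empty_subset _)).1
  exact ⟨c⁻¹ * a, inv_mul_mem_of_sameType i hG hM
    ((isInvariantOver_iff i (Set.empty_subset _)).1 hl.1) hl.2 hac, h⟩

theorem pow_mul_mem_interpSet (i : F ↪ₑ[fullGroupLang F] M)
    (hG : IsInterpretedGroup F M) {ρ : F →* CircleDeg1Liftˣ} {u v : F}
    (hu : ρ u = pushUnit) (hv : ρ v = pushUnit') {x y : M}
    (hx : x ∈ interpSet M {g : F | ∃ k : ℕ, g = u ^ (k + 1)})
    (hy : y ∈ interpSet M {g : F | ∃ k : ℕ, g = v ^ (k + 1)}) (n : ℕ) :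
    (x * y) ^ n ∈ interpSet M {g : F | ceilZero ρ g = n} := by
  have hxy := hG.mul_mem_interpSet i
    (C := {g : F | ∃ j k : ℕ, g = u ^ (j + 1) * v ^ (k + 1)})
    (by rintro _ ⟨j, rfl⟩ _ ⟨k, rfl⟩; exact ⟨j, k, rfl⟩) hx hy
  -- The value of `ceilZero` alone is too weak for the induction; the quarter-length interval is
  -- what `push_step` propagates.
  have h : (x * y) ^ n ∈ interpSet M {g : F | (n : ℝ) - 1 / 4 ≤ (ρ g : CircleDeg1Lift) 0 ∧
      (ρ g : CircleDeg1Lift) 0 ≤ n} := by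
    induction n with
    | zero =>
      rw [pow_zero]
      refine hG.one_mem_interpSet i ?_
      rw [Set.mem_ofPred_eq, map_one, Units.val_one, CircleDeg1Lift.coe_one]
      norm_num
    | succ n ih =>
      rw [pow_succ']
      refine hG.mul_mem_interpSet i ?_ hxy ih
      rintro _ ⟨j, k, rfl⟩ g ⟨h1, h2⟩
      have := push_step j k n h1 h2
      rw [Set.mem_ofPred_eq, map_mul, map_mul, map_pow, map_pow, hu, hv, Units.val_mul,
        Units.val_mul, CircleDeg1Lift.mul_apply, CircleDeg1Lift.mul_apply]
      exact this
  refine interpSet_mono i ?_ h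
  rintro g ⟨h1, h2⟩
  refine Int.ceil_eq_iff.2 ⟨?_, by simpa using h2⟩
  push_cast
  linarith

theorem component000_ne_component00 (i : F ↪ₑ[fullGroupLang F] M)
    (hG : IsInterpretedGroup F M)
    (hM : IsMonster (fullGroupLang F) M κ) {ρ : F →* CircleDeg1Liftˣ} {u v : F}
    (hu : ρ u = pushUnit) (hv : ρ v = pushUnit') :
    component000 (fullGroupLang F) κ (∅ : Set M) ≠
      component00 (fullGroupLang F) κ (∅ : Set M) := by
  intro heq
  obtain ⟨x, hx, hxu⟩ := exists_mem_component000_powers i hG hM u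
  obtain ⟨y, hy, hyv⟩ := exists_mem_component000_powers i hG hM v
  obtain ⟨S, hS⟩ := (isTypeDefinableOver_iff i (Set.empty_subset _)).1
    (isLeast_component00 i hG hM (Set.empty_subset _)).1.1
  rw [← heq] at hS
  have hmem (z : M) : z ∈ component000 (fullGroupLang F) κ (∅ : Set M) ↔
      ∀ D ∈ S, z ∈ interpSet M D := Set.ext_iff.1 hS z
  -- The integers `t k = (3 ^ k + 1) / 2` converge 3-adically to 1/2.
  have ht (k : ℕ) : ∃ t : ℕ, 3 ^ k + 1 = 2 * t := by
    obtain ⟨t, ht⟩ := Odd.pow (n := k) (show Odd 3 by decide)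
    exact ⟨t + 1, by omega⟩
  choose t ht using ht
  obtain ⟨z, hz⟩ := exists_forall_mem_interpSet hM
    (S ∪ Set.range fun k => residueSet ρ k (t k)) fun T hT hfin => by
      have hT' : ∀ D ∈ T, ∃ k, D ∈ S ∨ D = residueSet ρ k (t k) := fun D hD => by
        rcases hT hD with h | ⟨k, rfl⟩
        exacts [⟨0, Or.inl h⟩, ⟨k, Or.inr rfl⟩]
      choose! f hf using hT'
      obtain ⟨N, hN⟩ := (hfin.image f).bddAbove
      -- This power lies in the component, hence satisfies `S`, and it meets every congruence of
      -- level `k ≤ N` because `t N ≡ t k` modulo `3 ^ k`.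
      refine ⟨(x * y) ^ t N, fun D hD => ?_⟩
      rcases hf D hD with h | h
      · exact (hmem _).1 (pow_mem (mul_mem hx hy) _) D h
      · rw [h]
        refine interpSet_mono i ?_ (pow_mul_mem_interpSet i hG hu hv hxu hyv (t N))
        intro g hg
        have hk : f D ≤ N := hN ⟨D, hD, rfl⟩
        rw [Set.mem_ofPred_eq] at hg
        rw [residueSet, Set.mem_ofPred_eq, hg]
        refine (Int.modEq_iff_dvd.2 ?_)
        have h1 : (2 : ℤ) * (t (f D) - t N) = 3 ^ f D - 3 ^ N := by
          have e1 : (3 ^ f D + 1 : ℤ) = 2 * t (f D) := by exact_mod_cast ht (f D)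
          have e2 : (3 ^ N + 1 : ℤ) = 2 * t N := by exact_mod_cast ht N
          linarith
        have h2 : (3 : ℤ) ^ f D ∣ 2 * (t (f D) - t N) :=
          h1 ▸ dvd_sub dvd_rfl (pow_dvd_pow 3 hk)
        exact IsCoprime.dvd_of_dvd_mul_left
          (IsCoprime.pow_left (show IsCoprime (3 : ℤ) 2 from ⟨1, -1, by norm_num⟩)) h2
  have hz0 : z ∈ component000 (fullGroupLang F) κ (∅ : Set M) :=
    (hmem z).2 fun D hD => hz D (Or.inl hD)
  obtain ⟨n, hn⟩ : z ∈ residueSubgroup ρ i hG :=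
    (sInf_le (residueSubgroup_mem_invariantBounded ρ i hG hM) :
      component000 (fullGroupLang F) κ (∅ : Set M) ≤ _) hz0
  have hdvd (k : ℕ) : (3 : ℤ) ^ k ∣ 2 * n - 1 := by
    have h1 : z ∈ interpSet M (residueSet ρ k n ∩ residueSet ρ k (t k)) := by
      rw [interpSet_inter i]
      exact ⟨hn k, hz _ (Or.inr ⟨k, rfl⟩)⟩
    obtain ⟨g, hg1, hg2⟩ := nonempty_of_mem_interpSet i h1
    have h2 : (t k : ℤ) ≡ n [ZMOD 3 ^ k] := Int.ModEq.trans (Int.ModEq.symm hg2) hg1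
    have e1 : (3 ^ k + 1 : ℤ) = 2 * t k := by exact_mod_cast ht k
    have h3 : 2 * n - 1 = 2 * (n - t k) + 3 ^ k := by linarith
    rw [h3]
    exact dvd_add (Dvd.dvd.mul_left h2.dvd 2) dvd_rfl
  have h0 : 2 * n - 1 = 0 := by
    -- An integer `d` divisible by `3 ^ |d|` is zero, as `|d| < 3 ^ |d|`; but `2 * n - 1` is odd.
    refine Int.eq_zero_of_abs_lt_dvd (hdvd (2 * n - 1).natAbs) ?_
    rw [Int.abs_eq_natAbs]
    exact_mod_cast Nat.lt_pow_self (by norm_num : 1 < 3)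
  omega

end Comparison

theorem mainTheorem9 (m : ℕ) (hm : 2 ≤ m) (M : Type w) [(freeLang m).Structure M]
    (i : FreeGroup (Fin m) ↪ₑ[freeLang m] M)
    (κ : Cardinal.{w}) (hM : IsMonster (freeLang m) M κ) :
    letI : Group M := extensionGroup i
    -- the four components exist as smallest subgroups of the respective kind
    (IsLeast (invariantBounded (freeLang m) κ (Set.range i))
        (component000 (freeLang m) κ (Set.range i)) ∧
      IsLeast (invariantBounded (freeLang m) κ (∅ : Set M)) (component000 (freeLang m) κ ∅) ∧
      IsLeast (typeDefinableBounded (freeLang m) κ (∅ : Set M)) (component00 (freeLang m) κ ∅) ∧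
      IsLeast (typeDefinableBounded (freeLang m) κ (Set.range i))
        (component00 (freeLang m) κ (Set.range i))) ∧
    -- the comparison of the components
    component000 (freeLang m) κ (Set.range i) = component000 (freeLang m) κ (∅ : Set M) ∧
    component000 (freeLang m) κ (∅ : Set M) ≠ component00 (freeLang m) κ (∅ : Set M) ∧
    component00 (freeLang m) κ (∅ : Set M) = component00 (freeLang m) κ (Set.range i) := by
  let : Group M := extensionGroup i
  have hG : IsInterpretedGroup (FreeGroup (Fin m)) M := ⟨fun _ _ => rfl, fun _ => rfl⟩
  have h0 : (∅ : Set M) ⊆ Set.range i := Set.empty_subset _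
  let ρ : FreeGroup (Fin m) →* CircleDeg1Liftˣ :=
    FreeGroup.lift fun j => if (j : ℕ) = 0 then pushUnit else pushUnit'
  refine ⟨⟨isLeast_component000 i hG hM subset_rfl, isLeast_component000 i hG hM h0,
    isLeast_component00 i hG hM h0, isLeast_component00 i hG hM subset_rfl⟩,
    component000_eq i subset_rfl, ?_, (component00_eq i subset_rfl).symm⟩
  exact component000_ne_component00 i hG hM (ρ := ρ) (u := .of ⟨0, by omega⟩)
    (v := .of ⟨1, by omega⟩) (by simp [ρ]) (by simp [ρ])
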